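/- Let $G$ be an abelian topological group (written additively), let $\mathbb{F}$ be $\mathbb{R}$ or $\mathbb{C}$, and let $f : G \to \mathbb{F}$ be a bounded continuous function that is almost periodic, i.e. the set $\{T_s f : s \in G\}$ of its translates, $(T_s f)(x) = f(s+x)$, is totally bounded in the supremum norm. Let $G_f$ be the completion of $G$ with respect to the translation-invariant pseudometric $d_f(a,b) = \sup_{x \in G} |f(a+x) - f(b+x)|$, with canonical homomorphism $\iota : G \to G_f$. Then: 1. $G_f$ is a compact abelian group, and its character group $\Sigma = G_f^{*}$, the group of continuous homomorphisms $\sigma$ from $G_f$ to the unit circle (with $\chi_\sigma : G_f \to \mathbb{C}$ denoting $\sigma$ as a complex function), is discrete. 2. $f$ extends to $G_f$: there is exactly one continuous function $F : G_f \to \mathbb{F}$ with $F \circ \iota = f$. 3. Let $\mu$ be the Haar measure on $G_f$ with $\mu(G_f) = 1$, regard $F$ as a complex-valued function, and for integrable $\Phi : G_f \to \mathbb{C}$ put $\hat{\Phi}(\sigma) = \int_{G_f} \Phi\, \overline{\chi_\sigma}\, d\mu$; write $\hat f = \hat F$. Then $\hat f \in \ell_2(\Sigma)$ and $\sum_{\sigma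 \in \Sigma} |\hat f(\sigma)|^2 = \int_{G_f} |F|^2\, d\mu$. Moreover $f = \sum_{\sigma \in \Sigma} \hat f(\sigma) \chi_\sigma$ in the $L_2$ sense: the finite partial sums $S_s = \sum_{\sigma \in s} \hat f(\sigma)\chi_\sigma$, $s \subset \Sigma$ finite, converge (unconditionally, along the directed set of finite subsets of $\Sigma$) to $F$ in $L_2(G_f, \mu)$, and their Fourier transforms $\hat{S_s}$ converge to $\hat f$ in $\ell_2(\Sigma)$. -/

import Mathlib

open MeasureTheory Filter Topology UniformSpace
open scoped BoundedContinuousFunction ENNReal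

noncomputable section

namespace AlmostPeriodic

section Pseudometric

variable {G : Type*} [AddCommGroup G] [TopologicalSpace G] {𝕜 : Type*} [RCLike 𝕜]

/-- The function `d_f(a, b) = sup_x |f(a + x) - f(b + x)|` on `G × G`. -/
def dF (f : G →ᵇ 𝕜) (a b : G) : ℝ := ⨆ x : G, ‖f (a + x) - f (b + x)‖

theorem dF_add_left (f : G →ᵇ 𝕜) (c a b : G) : dF f (c + a) (c + b) = dF f a b := by
  unfold dF
  refine (Equiv.addLeft c).iSup_congr fun x => ?_
  simp only [Equiv.coe_addLeft]
  congr 3 <;> abel_nf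

end Pseudometric

section Translates

variable {G : Type*} [AddCommGroup G] [TopologicalSpace G] [IsTopologicalAddGroup G]
  {𝕜 : Type*} [RCLike 𝕜]

/-- The translation operator `T_s` on bounded continuous functions: `(T_s f) x = f (s + x)`. -/
def translate (s : G) (f : G →ᵇ 𝕜) : G →ᵇ 𝕜 :=
  f.compContinuous ⟨fun x => s + x, continuous_const.add continuous_id⟩

/-- A bounded continuous function `f` is almost periodic if the set of its translates
`S_f = {T_s f : s ∈ G}` is totally bounded for the supremum norm. -/
def IsAlmostPeriodic (f : G →ᵇ 𝕜) : Prop :=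
  TotallyBounded (Set.range fun s : G => translate s f)

theorem dF_eq (f : G →ᵇ 𝕜) (a b : G) :
    dF f a b = dist (translate a f) (translate b f) := by
  rw [BoundedContinuousFunction.dist_eq_iSup]
  simp [dF, translate, dist_eq_norm]

theorem dF_self (f : G →ᵇ 𝕜) (a : G) : dF f a a = 0 := by
  rw [dF_eq, dist_self]

theorem dF_comm (f : G →ᵇ 𝕜) (a b : G) : dF f a b = dF f b a := by
  rw [dF_eq, dF_eq, dist_comm]

theorem dF_triangle (f : G →ᵇ 𝕜) (a b c : G) : dF f a c ≤ dF f a b + dF f b c := by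
  rw [dF_eq, dF_eq, dF_eq]
  exact dist_triangle _ _ _

/-- The group `G` with its given topology forgotten; it carries the pseudometric `d_f` instead. -/
def PreGroup (_f : G →ᵇ 𝕜) : Type _ := G

variable (f : G →ᵇ 𝕜)

instance : AddCommGroup (PreGroup f) := inferInstanceAs (AddCommGroup G)

instance : PseudoMetricSpace (PreGroup f) where
  dist a b := dF f a b
  dist_self := dF_self f
  dist_comm := dF_comm f
  dist_triangle := dF_triangle f

theorem preGroup_dist_add_left (c a b : PreGroup f) : dist (c + a) (c + b) = dist a b :=
  dF_add_left f c a b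

instance : IsUniformAddGroup (PreGroup f) := by
  refine ⟨?_⟩
  have key : ∀ a b c d : PreGroup f, dist (a - b) (c - d) ≤ dist a c + dist b d := by
    intro a b c d
    have h1 : dist (a - b) (c - b) = dist a c := by
      rw [← preGroup_dist_add_left f b (a - b) (c - b)]
      congr 1 <;> abel
    have h2 : dist (c - b) (c - d) = dist b d := by
      rw [← preGroup_dist_add_left f (b + d - c) (c - b) (c - d), dist_comm b d]
      congr 1 <;> abel
    calc dist (a - b) (c - d) ≤ dist (a - b) (c - b) + dist (c - b) (c - d) :=
          dist_triangle _ _ _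
      _ = dist a c + dist b d := by rw [h1, h2]
  rw [Metric.uniformContinuous_iff]
  intro ε hε
  refine ⟨ε / 2, half_pos hε, ?_⟩
  rintro ⟨a, b⟩ ⟨c, d⟩ h
  rw [Prod.dist_eq, max_lt_iff] at h
  have := key a b c d
  simp only at h ⊢
  linarith [h.1, h.2]

/-- The group `G_f`: the completion of `(G, d_f)`, a complete metric abelian group. -/
abbrev CompletedGroup : Type _ := Completion (PreGroup f)

/-- The canonical homomorphism `G → G_f`. -/
def toCompleted : G →+ CompletedGroup f :=
  (Completion.toCompl : PreGroup f →+ Completion (PreGroup f))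

theorem dist_toCompleted (a b : G) :
    dist (toCompleted f a) (toCompleted f b) = dF f a b :=
  Completion.dist_eq (α := PreGroup f) a b

theorem denseRange_toCompleted : DenseRange (toCompleted f) :=
  Completion.denseRange_coe (α := PreGroup f)

instance : MeasurableSpace (CompletedGroup f) := borel _

instance : BorelSpace (CompletedGroup f) := ⟨rfl⟩

variable {f} in
theorem IsAlmostPeriodic.compactSpace (hf : IsAlmostPeriodic f) :
    CompactSpace (CompletedGroup f) := by
  have hiso : Isometry (fun s : PreGroup f => translate (G := G) s f) :=
    Isometry.of_dist_eq fun a b => (dF_eq f a b).symm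
  have h1 : TotallyBounded (Set.univ : Set (PreGroup f)) := by
    rw [← totallyBounded_image_iff hiso.isUniformInducing, Set.image_univ]
    exact hf
  have h2 : TotallyBounded (Set.range ((↑) : PreGroup f → Completion (PreGroup f))) := by
    rw [← Set.image_univ]
    exact h1.image (Completion.uniformContinuous_coe _)
  have h3 := h2.closure
  rw [Completion.denseRange_coe.closure_range] at h3
  exact ⟨isCompact_iff_totallyBounded_isComplete.2 ⟨h3, isComplete_univ⟩⟩

/-- Haar measure on the compact group `G_f`, normalized to total mass one. -/
def haar (hf : IsAlmostPeriodic f) : Measure (CompletedGroup f) :=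
  haveI := hf.compactSpace
  Measure.addHaarMeasure ⊤

instance (hf : IsAlmostPeriodic f) : (haar f hf).IsAddHaarMeasure := by
  have := hf.compactSpace
  unfold haar
  infer_instance

instance (hf : IsAlmostPeriodic f) : IsProbabilityMeasure (haar f hf) := by
  have := hf.compactSpace
  exact ⟨Measure.addHaarMeasure_self (K₀ := (⊤ : TopologicalSpace.PositiveCompacts _))⟩

/-- The character group `Σ` of `G_f`: continuous homomorphisms from `G_f` to the unit circle. -/
abbrev CharGroup : Type _ := PontryaginDual (Multiplicative (CompletedGroup f))

variable {f}

/-- The character `χ_σ : G_f → ℂ`. -/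
def chi (σ : CharGroup f) (x : CompletedGroup f) : ℂ := (σ (Multiplicative.ofAdd x) : Circle)

/-- The Fourier coefficient `F̂(σ) = ∫ F χ̄_σ dμ`, with `μ` normalized Haar measure on `G_f`. -/
def fourierCoeff (hf : IsAlmostPeriodic f) (F : CompletedGroup f → ℂ) (σ : CharGroup f) : ℂ :=
  ∫ x, F x * (starRingEnd ℂ) (chi σ x) ∂(haar f hf)

/-- The finite partial sum `∑_{σ ∈ s} F̂(σ) χ_σ` of the Fourier series of `F`. -/
def fourierSum (hf : IsAlmostPeriodic f) (F : CompletedGroup f → ℂ) (s : Finset (CharGroup f))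
    (x : CompletedGroup f) : ℂ :=
  ∑ σ ∈ s, fourierCoeff hf F σ * chi σ x

end Translates

end AlmostPeriodic

end

/-!
# Fourier series of almost periodic functions

Almost periodicity of `f` says that `G` with the pseudometric `d_f` is totally bounded, so its
completion `G_f` is a compact metrizable abelian group, and the dual of a compact group is discrete.
Since `|f a - f b| ≤ d_f(a, b)`, the function `f` is uniformly continuous for `d_f` and extends
uniquely to `G_f` (`AlmostPeriodic.existsUnique_extension`).

The substance is the Peter–Weyl theorem for a compact second countable abelian group `K`: the
characters form a Hilbert basis of `L²(K)` (`CompactAbelian.characterBasis`). They are orthonormal,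
and completeness means that the space `W` of functions orthogonal to all of them is zero. For a
continuous `k` with `k x = conj (k (-x))`, convolution with `k` is a self-adjoint operator on `L²(K)`
by Fubini, compact by Arzelà–Ascoli, and it commutes with translations. Characters are eigenvectors
of convolutions and translations, so both preserve `W`. If the convolution did not vanish on `W`, it
would have a nonzero eigenvalue there, with a finite-dimensional translation-invariant eigenspace
(`IsCompactOperator.exists_common_eigenvector`). The commuting translations then have a common
eigenvector `φ` in `W`. As an eigenvector of a convolution, `φ` is continuous; being an eigenvector
of all translations, it is a multiple of a character (`CompactAbelian.exists_eq_smul_character`), and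
cannot be orthogonal to all characters. Hence all these convolutions vanish on `W`, and since
continuous functions are dense, `W = 0`
(`CompactAbelian.eq_zero_of_forall_convolutionLp_eq_zero`).

Plancherel's identity and `L²` convergence are then the expansion in a Hilbert basis. By
orthonormality the partial sum over `s` has the same coefficients as the function on `s` and zero
coefficients elsewhere, so convergence in `ℓ²` is the vanishing of the tails of a convergent series.
-/

/-! ### Common eigenvectors -/

/-- Commuting endomorphisms have a common eigenvector in every nonzero finite-dimensional invariant
subspace: cut the subspace down by an eigenspace of an operator that is not scalar on it. -/
theorem Submodule.exists_common_eigenvector {ι E : Type*} [AddCommGroup E] [Module ℂ E]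
    (U : ι → E →ₗ[ℂ] E) (hU : ∀ i j x, U i (U j x) = U j (U i x)) (n : ℕ) (M : Submodule ℂ E)
    [FiniteDimensional ℂ M] (hn : Module.finrank ℂ M = n) (hM : M ≠ ⊥)
    (hinv : ∀ i, ∀ x ∈ M, U i x ∈ M) :
    ∃ v ∈ M, v ≠ 0 ∧ ∀ i, ∃ c : ℂ, U i v = c • v := by
  induction n using Nat.strongRecOn generalizing M with | ind n ih => ?_
  by_cases h : ∀ i, ∃ c : ℂ, ∀ x ∈ M, U i x = c • x
  · obtain ⟨v, hv, hv0⟩ := M.exists_mem_ne_zero_of_ne_bot hM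
    exact ⟨v, hv, hv0, fun i => (h i).imp fun c hc => hc v hv⟩
  push Not at h
  obtain ⟨i, hi⟩ := h
  have : Nontrivial M := Submodule.nontrivial_iff_ne_bot.2 hM
  obtain ⟨c, hc⟩ := Module.End.exists_eigenvalue ((U i).restrict (hinv i))
  obtain ⟨w, hw⟩ := hc.exists_hasEigenvector
  have hwU : U i w = c • (w : E) := congrArg Subtype.val hw.apply_eq_smul
  let N : Submodule ℂ E := M ⊓ Module.End.eigenspace (U i) c
  have hlt : N < M := by
    refine lt_of_le_of_ne inf_le_left fun hNM => ?_
    obtain ⟨x, hx, hxc⟩ := hi c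
    exact hxc (Module.End.mem_eigenspace_iff.1 (hNM.ge hx).2)
  have : FiniteDimensional ℂ N := Submodule.finiteDimensional_of_le hlt.le
  obtain ⟨v, hv, hv'⟩ := ih _ (hn ▸ Submodule.finrank_lt_finrank_of_lt hlt) N rfl
    (fun h0 => hw.2 <| Subtype.ext <| (Submodule.eq_bot_iff _).1 h0 _
      ⟨w.2, Module.End.mem_eigenspace_iff.2 hwU⟩)
    (fun j x hx => ⟨hinv j x hx.1, Module.End.mem_eigenspace_iff.2 <| by
      rw [hU, Module.End.mem_eigenspace_iff.1 hx.2, map_smul]⟩)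
  exact ⟨v, hv.1, hv'⟩

/-- A compact self-adjoint operator that does not vanish on a closed invariant subspace `W` has an
eigenvector in `W` with nonzero eigenvalue. The corresponding eigenspace is finite-dimensional, so
the eigenvector can be chosen as a common eigenvector of any family of operators that commute with
each other and with the given one and preserve `W`. -/
theorem IsCompactOperator.exists_common_eigenvector {ι H : Type*} [NormedAddCommGroup H]
    [InnerProductSpace ℂ H] [CompleteSpace H] {A : H →L[ℂ] H} (hA : IsCompactOperator A)
    (hsymm : A.IsSymmetric) (U : ι → H →ₗ[ℂ] H) (hU : ∀ i j x, U i (U j x) = U j (U i x))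
    (hAU : ∀ i x, A (U i x) = U i (A x)) (W : Submodule ℂ H) [CompleteSpace W]
    (hAW : ∀ x ∈ W, A x ∈ W) (hUW : ∀ i, ∀ x ∈ W, U i x ∈ W) {w : H} (hw : w ∈ W) (hAw : A w ≠ 0) :
    ∃ l : ℂ, l ≠ 0 ∧ ∃ v ∈ W, v ≠ 0 ∧ A v = l • v ∧ ∀ i, ∃ c : ℂ, U i v = c • v := by
  let R : W →L[ℂ] W := A.restrict hAW
  have hR : IsCompactOperator R := hA.restrict' hAW
  have hRsymm : R.IsSymmetric := hsymm.restrict_invariant hAW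
  have hR0 : R ≠ 0 := fun h0 =>
    hAw (congrArg Subtype.val (DFunLike.congr_fun h0 (⟨w, hw⟩ : W)))
  rw [Ne, ← ContinuousLinearMap.eq_zero_of_forall_hasEigenvalue_eq_zero hR hRsymm] at hR0
  push Not at hR0
  obtain ⟨l, hl, hl0⟩ := hR0
  obtain ⟨u, hu, hu0⟩ := hl.exists_hasEigenvector
  have hul : A u = l • (u : H) := congrArg Subtype.val (Module.End.mem_eigenspace_iff.1 hu)
  have := ContinuousLinearMap.finite_dimensional_eigenspace hA l hl0
  let M : Submodule ℂ H := Module.End.eigenspace A.toLinearMap l ⊓ W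
  have : FiniteDimensional ℂ M := Submodule.finiteDimensional_of_le inf_le_left
  obtain ⟨v, hv, hv0, hvU⟩ := Submodule.exists_common_eigenvector U hU _ M rfl
    (fun h0 => hu0 <| Subtype.ext <| (Submodule.eq_bot_iff _).1 h0 _
      ⟨Module.End.mem_eigenspace_iff.2 hul, u.2⟩)
    (fun i x hx => ⟨Module.End.mem_eigenspace_iff.2 <| by
      have h : A x = l • x := Module.End.mem_eigenspace_iff.1 hx.1
      exact (hAU i x).trans (by rw [h, map_smul]), hUW i x hx.2⟩)
  exact ⟨l, hl0, v, hv.2, hv0, Module.End.mem_eigenspace_iff.1 hv.1, hvU⟩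

/-! ### Compact operators into spaces of continuous functions -/

section InnerOperator

variable {X H : Type*} [TopologicalSpace X] [CompactSpace X] [NormedAddCommGroup H]
  [InnerProductSpace ℂ H]

/-- The operator `v ↦ (x ↦ ⟪g x, v⟫)` from a Hilbert space to `C(X, ℂ)` given by a continuous family
`g` of vectors. -/
noncomputable def ContinuousMap.innerOperator (g : C(X, H)) : H →L[ℂ] C(X, ℂ) :=
  LinearMap.mkContinuous
    { toFun := fun v => ⟨fun x => inner ℂ (g x) v, by fun_prop⟩
      map_add' := fun v w => by ext x; simp
      map_smul' := fun c v => by ext x; simp } ‖g‖ fun v => by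
    rw [ContinuousMap.norm_le _ (by positivity)]
    intro x
    exact (norm_inner_le_norm _ _).trans (by gcongr; exact g.norm_coe_le_norm x)

/-- By Arzelà–Ascoli: the images of the unit ball are equicontinuous because `g` is continuous. -/
theorem ContinuousMap.isCompactOperator_innerOperator (g : C(X, H)) :
    IsCompactOperator g.innerOperator := by
  let e := ContinuousMap.linearIsometryBoundedOfCompact X ℂ ℂ
  let A : Set (X →ᵇ ℂ) := (fun v => e (g.innerOperator v)) '' Metric.ball 0 1
  have hA : IsCompact (closure A) := by
    refine BoundedContinuousFunction.arzela_ascoli (Metric.closedBall 0 ‖g‖)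
      (isCompact_closedBall _ _) A ?_ ?_
    · rintro _ x ⟨v, hv, rfl⟩
      rw [mem_ball_zero_iff] at hv
      rw [mem_closedBall_zero_iff]
      calc ‖inner ℂ (g x) v‖ ≤ ‖g x‖ * ‖v‖ := norm_inner_le_norm _ _
        _ ≤ ‖g‖ * 1 := by gcongr; exact g.norm_coe_le_norm x
        _ = ‖g‖ := mul_one _
    · intro x₀
      rw [Metric.equicontinuousAt_iff_right]
      intro ε hε
      filter_upwards [Metric.continuousAt_iff'.1 g.continuous.continuousAt ε hε] with x hx
      rintro ⟨_, v, hv, rfl⟩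
      rw [mem_ball_zero_iff] at hv
      change dist (inner ℂ (g x₀) v) (inner ℂ (g x) v) < ε
      rw [dist_eq_norm, ← inner_sub_left]
      calc _ ≤ ‖g x₀ - g x‖ * ‖v‖ := norm_inner_le_norm _ _
        _ ≤ ‖g x₀ - g x‖ * 1 := by gcongr
        _ < ε := by rwa [mul_one, ← dist_eq_norm, dist_comm]
  refine ⟨e.symm '' closure A, hA.image e.symm.continuous, ?_⟩
  filter_upwards [Metric.ball_mem_nhds 0 one_pos] with v hv
  exact ⟨_, subset_closure ⟨v, hv, rfl⟩, e.symm_apply_apply _⟩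

end InnerOperator

namespace CompactAbelian

/-! ### Characters as continuous functions -/

section Characters

variable {K : Type*} [AddCommGroup K] [TopologicalSpace K]

/-- A character of `K` as a complex-valued continuous function. -/
noncomputable def character (σ : PontryaginDual (Multiplicative K)) : C(K, ℂ) :=
  ⟨fun x => (σ (Multiplicative.ofAdd x) : Circle),
    continuous_subtype_val.comp ((map_continuous σ).comp continuous_ofAdd)⟩

theorem character_add (σ : PontryaginDual (Multiplicative K)) (x y : K) :
    character σ (x + y) = character σ x * character σ y := by
  simp [character, ofAdd_add, map_mul]

theorem norm_character (σ : PontryaginDual (Multiplicative K)) (x : K) :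
    ‖character σ x‖ = 1 := Circle.norm_coe _

theorem conj_character_mul_self (σ : PontryaginDual (Multiplicative K)) (x : K) :
    (starRingEnd ℂ) (character σ x) * character σ x = 1 := by
  rw [Complex.conj_mul', norm_character]; simp

theorem character_injective : Function.Injective (character (K := K)) := by
  intro σ τ h
  ext x
  exact DFunLike.congr_fun h (Multiplicative.toAdd x)

/-- A continuous, multiplicative, unimodular function is a character. -/
theorem exists_character_eq (c : C(K, ℂ)) (hadd : ∀ x y, c (x + y) = c x * c y)
    (hnorm : ∀ x, ‖c x‖ = 1) : ∃ σ, character σ = c := by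
  let u : Multiplicative K →* Circle := MonoidHom.mk'
    (fun x => ⟨c x.toAdd, mem_sphere_zero_iff_norm.2 (hnorm _)⟩)
    fun x y => Subtype.ext (hadd _ _)
  exact ⟨(⟨u, Continuous.subtype_mk (c.continuous.comp continuous_toAdd) _⟩ :
    Multiplicative K →ₜ* Circle), rfl⟩

end Characters

/-! ### Pairing with continuous functions, and convolution -/

section Pairing

variable {K : Type*} [TopologicalSpace K] [CompactSpace K] [MeasurableSpace K] [BorelSpace K]
  (μ : Measure K) [IsProbabilityMeasure μ]

theorem inner_toLp_left (g : C(K, ℂ)) (φ : Lp ℂ 2 μ) :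
    inner ℂ (ContinuousMap.toLp 2 μ ℂ g) φ = ∫ y, (starRingEnd ℂ) (g y) * φ y ∂μ := by
  rw [L2.inner_def]
  refine integral_congr_ae ?_
  filter_upwards [ContinuousMap.coeFn_toLp (p := 2) (𝕜 := ℂ) μ g] with y hy
  rw [hy, RCLike.inner_apply, mul_comm]

end Pairing

section Orthogonal

variable {K : Type*} [AddCommGroup K] [TopologicalSpace K] [CompactSpace K] [MeasurableSpace K]
  [BorelSpace K] (μ : Measure K) [IsProbabilityMeasure μ]

/-- The elements of `L²(K)` orthogonal to every character. -/
noncomputable def characterOrthogonal : Submodule ℂ (Lp ℂ 2 μ) :=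
  (Submodule.span ℂ (Set.range fun σ : PontryaginDual (Multiplicative K) =>
    ContinuousMap.toLp 2 μ ℂ (character σ)))ᗮ

theorem mem_characterOrthogonal (φ : Lp ℂ 2 μ) : φ ∈ characterOrthogonal μ ↔
    ∀ σ, inner ℂ (ContinuousMap.toLp 2 μ ℂ (character σ)) φ = 0 := by
  refine ⟨fun h σ => Submodule.inner_right_of_mem_orthogonal
    (Submodule.subset_span (Set.mem_range_self σ)) h, fun h => ?_⟩
  rw [characterOrthogonal, Submodule.mem_orthogonal]
  intro u hu
  induction hu using Submodule.span_induction with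
  | mem u hu => obtain ⟨σ, rfl⟩ := hu; exact h σ
  | zero => exact inner_zero_left _
  | add u v _ _ hu hv => rw [inner_add_left, hu, hv, add_zero]
  | smul c u _ hu => rw [inner_smul_left, hu, mul_zero]

end Orthogonal

section Convolution

variable {K : Type*} [AddCommGroup K] [TopologicalSpace K] [IsTopologicalAddGroup K]

/-- The convolution adjoint `x ↦ conj (k (-x))`. -/
noncomputable def involution (k : C(K, ℂ)) : C(K, ℂ) :=
  ⟨fun x => (starRingEnd ℂ) (k (-x)), by fun_prop⟩

theorem involution_apply (k : C(K, ℂ)) (x : K) :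
    involution k x = (starRingEnd ℂ) (k (-x)) := rfl

variable [CompactSpace K] [MeasurableSpace K] [BorelSpace K]
  (μ : Measure K) [IsProbabilityMeasure μ]

/-- For `x : K`, the function `y ↦ conj (k (x - y))`, whose inner product with `φ` is the
convolution of `k` and `φ` at `x`. -/
noncomputable def convolutionKernel (k : C(K, ℂ)) : C(K, Lp ℂ 2 μ) :=
  ContinuousMap.comp ⟨ContinuousMap.toLp 2 μ ℂ, (ContinuousMap.toLp 2 μ ℂ).continuous⟩
    (ContinuousMap.curry ⟨fun p : K × K => (starRingEnd ℂ) (k (p.1 - p.2)), by fun_prop⟩)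

/-- Convolution with the continuous function `k`, as an operator from `L²(K)` to `C(K)`. -/
noncomputable def convolution (k : C(K, ℂ)) : Lp ℂ 2 μ →L[ℂ] C(K, ℂ) :=
  (convolutionKernel μ k).innerOperator

theorem convolution_apply (k : C(K, ℂ)) (φ : Lp ℂ 2 μ) (x : K) :
    convolution μ k φ x = ∫ y, k (x - y) * φ y ∂μ := by
  refine (inner_toLp_left μ _ φ).trans ?_
  simp

theorem convolution_toLp_apply (k g : C(K, ℂ)) (x : K) :
    convolution μ k (ContinuousMap.toLp 2 μ ℂ g) x = ∫ y, k (x - y) * g y ∂μ := by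
  rw [convolution_apply]
  refine integral_congr_ae ?_
  filter_upwards [ContinuousMap.coeFn_toLp (p := 2) (𝕜 := ℂ) μ g] with y hy
  rw [hy]

/-- Convolution with `k` as an operator on `L²(K)`. -/
noncomputable def convolutionLp (k : C(K, ℂ)) : Lp ℂ 2 μ →L[ℂ] Lp ℂ 2 μ :=
  ContinuousMap.toLp 2 μ ℂ ∘L convolution μ k

theorem convolutionLp_apply (k : C(K, ℂ)) (φ : Lp ℂ 2 μ) :
    convolutionLp μ k φ = ContinuousMap.toLp 2 μ ℂ (convolution μ k φ) := rfl

theorem isCompactOperator_convolutionLp (k : C(K, ℂ)) : IsCompactOperator (convolutionLp μ k) :=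
  (convolutionKernel μ k).isCompactOperator_innerOperator.clm_comp (ContinuousMap.toLp 2 μ ℂ)

end Convolution

/-! ### Translations in the space of square-integrable functions -/

variable {K : Type*} [AddCommGroup K] [TopologicalSpace K] [IsTopologicalAddGroup K]
  [MeasurableSpace K] [BorelSpace K] (μ : Measure K) [μ.IsAddHaarMeasure]

/-- Translation `φ ↦ φ(· + a)` on `L²(K)`. -/
noncomputable def translation (a : K) : Lp ℂ 2 μ →ₗᵢ[ℂ] Lp ℂ 2 μ :=
  Lp.compMeasurePreservingₗᵢ ℂ (· + a) (measurePreserving_add_right μ a)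

theorem coeFn_translation (a : K) (φ : Lp ℂ 2 μ) :
    translation μ a φ =ᵐ[μ] fun x => φ (x + a) :=
  Lp.coeFn_compMeasurePreserving φ (measurePreserving_add_right μ a)

theorem translation_comm (a b : K) (φ : Lp ℂ 2 μ) :
    translation μ a (translation μ b φ) = translation μ b (translation μ a φ) := by
  have key : ∀ a b : K, translation μ a (translation μ b φ) =ᵐ[μ] fun x => φ (x + a + b) := by
    intro a b
    refine (coeFn_translation μ a _).trans ?_
    exact (measurePreserving_add_right μ a).quasiMeasurePreserving.ae (coeFn_translation μ b φ)
  apply Lp.ext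
  refine (key a b).trans ((key b a).trans (Eventually.of_forall fun x => ?_)).symm
  simp only [add_right_comm]

variable [CompactSpace K] [IsProbabilityMeasure μ]

theorem translation_toLp (a : K) (g : C(K, ℂ)) :
    translation μ a (ContinuousMap.toLp 2 μ ℂ g) =
      ContinuousMap.toLp 2 μ ℂ (g.comp ⟨(· + a), by fun_prop⟩) := by
  apply Lp.ext
  refine (coeFn_translation μ a _).trans ?_
  filter_upwards [ContinuousMap.coeFn_toLp (p := 2) (𝕜 := ℂ) μ (g.comp ⟨(· + a), by fun_prop⟩),
    (measurePreserving_add_right μ a).quasiMeasurePreserving.ae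
      (ContinuousMap.coeFn_toLp (p := 2) (𝕜 := ℂ) μ g)] with x h1 h2
  rw [h1, h2]; rfl

theorem translation_character (a : K) (σ : PontryaginDual (Multiplicative K)) :
    translation μ a (ContinuousMap.toLp 2 μ ℂ (character σ)) =
      character σ a • ContinuousMap.toLp 2 μ ℂ (character σ) := by
  rw [translation_toLp, ← map_smul]
  congr 1
  ext x
  simp [character_add, mul_comm]

theorem convolution_translation (k : C(K, ℂ)) (a : K) (φ : Lp ℂ 2 μ) (x : K) :
    convolution μ k (translation μ a φ) x = convolution μ k φ (x + a) := by
  rw [convolution_apply, convolution_apply,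
    ← integral_add_right_eq_self (fun y => k (x + a - y) * φ y) a]
  refine integral_congr_ae ?_
  filter_upwards [coeFn_translation μ a φ] with y hy
  rw [hy, add_sub_add_right_eq_sub]

theorem convolutionLp_translation (k : C(K, ℂ)) (a : K) (φ : Lp ℂ 2 μ) :
    convolutionLp μ k (translation μ a φ) = translation μ a (convolutionLp μ k φ) := by
  rw [convolutionLp_apply, convolutionLp_apply, translation_toLp]
  congr 1
  ext x
  exact convolution_translation μ k a φ x

/-! ### Characters as eigenvectors -/

/-- Characters are eigenvectors of convolutions: substitute `y = x - z` in the integral. -/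
theorem convolutionLp_character (k : C(K, ℂ)) (σ : PontryaginDual (Multiplicative K)) :
    ∃ c : ℂ, convolutionLp μ k (ContinuousMap.toLp 2 μ ℂ (character σ)) =
      c • ContinuousMap.toLp 2 μ ℂ (character σ) := by
  refine ⟨∫ z, k z * character σ (-z) ∂μ, ?_⟩
  rw [convolutionLp_apply, ← map_smul]
  congr 1
  ext x
  rw [convolution_toLp_apply, ← integral_sub_left_eq_self _ μ x, ContinuousMap.smul_apply,
    smul_eq_mul, ← integral_mul_const]
  refine integral_congr_ae (Eventually.of_forall fun z => ?_)
  simp only [sub_sub_cancel]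
  rw [sub_eq_add_neg, character_add]
  ring

/-- Distinct characters are orthogonal: their inner product is multiplied by
`conj (σ a) * τ a` under translation by `a`. -/
theorem orthonormal_character : Orthonormal ℂ fun σ : PontryaginDual (Multiplicative K) =>
    ContinuousMap.toLp 2 μ ℂ (character σ) := by
  have hself : ∀ σ, inner ℂ (ContinuousMap.toLp 2 μ ℂ (character σ))
      (ContinuousMap.toLp 2 μ ℂ (character σ)) = 1 := by
    intro σ
    rw [ContinuousMap.inner_toLp]
    simp [mul_comm (character σ _), conj_character_mul_self]
  refine ⟨fun σ => ?_, fun σ τ hστ => ?_⟩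
  · have h := inner_self_eq_norm_sq_to_K (𝕜 := ℂ) (ContinuousMap.toLp 2 μ ℂ (character σ))
    rw [hself] at h
    have h' : ‖ContinuousMap.toLp 2 μ ℂ (character σ)‖ ^ 2 = 1 := Complex.ofReal_injective <| by
      rw [Complex.ofReal_pow, Complex.ofReal_one]
      exact h.symm
    exact (pow_eq_one_iff_of_nonneg (norm_nonneg _) two_ne_zero).1 h'
  · by_contra h0
    refine hστ (character_injective (ContinuousMap.ext fun a => ?_))
    have h := (translation μ a).inner_map_map (ContinuousMap.toLp 2 μ ℂ (character σ))
      (ContinuousMap.toLp 2 μ ℂ (character τ))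
    rw [translation_character, translation_character, inner_smul_left, inner_smul_right,
      ← mul_assoc] at h
    have h1 := mul_right_cancel₀ h0 (h.trans (one_mul _).symm)
    linear_combination (-character σ a) * h1 + character τ a * conj_character_mul_self σ a

/-- Translations are isometries and act on characters by unimodular scalars. -/
theorem translation_mem_characterOrthogonal (a : K) (φ : Lp ℂ 2 μ)
    (hφ : φ ∈ characterOrthogonal μ) : translation μ a φ ∈ characterOrthogonal μ := by
  rw [mem_characterOrthogonal] at hφ ⊢
  intro σ
  have h := hφ σ
  rw [← (translation μ a).inner_map_map, translation_character, inner_smul_left, mul_eq_zero] at h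
  refine h.resolve_left fun h0 => ?_
  simpa [h0] using conj_character_mul_self σ a

/-- A common eigenvector of all translations that is also an eigenvector of a convolution operator
is a continuous function, and hence a multiple of a character. -/
theorem exists_eq_smul_character {k : C(K, ℂ)} {l : ℂ} (hl : l ≠ 0) {φ : Lp ℂ 2 μ} (hφ0 : φ ≠ 0)
    (hk : convolutionLp μ k φ = l • φ) (hφ : ∀ a, ∃ c : ℂ, translation μ a φ = c • φ) :
    ∃ (d : ℂ) (σ : _), φ = d • ContinuousMap.toLp 2 μ ℂ (character σ) := by
  choose c hc using hφ
  have hφl : φ = l⁻¹ • ContinuousMap.toLp 2 μ ℂ (convolution μ k φ) := by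
    rw [← convolutionLp_apply, hk, inv_smul_smul₀ hl]
  -- As a continuous function, the convolution satisfies the eigenvector equation pointwise.
  have hg : ∀ x a, convolution μ k φ (x + a) = c a * convolution μ k φ x := by
    intro x a
    rw [← convolution_translation, hc, map_smul]; rfl
  have hg0 : convolution μ k φ 0 ≠ 0 := by
    intro h0
    have : convolution μ k φ = 0 := by
      ext x
      simpa [h0] using hg 0 x
    rw [this, map_zero, smul_zero] at hφl
    exact hφ0 hφl
  -- Evaluation at `0` identifies the eigenvalues with the convolution, up to a constant.
  have hcg : ∀ a, c a = (convolution μ k φ 0)⁻¹ * convolution μ k φ a := by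
    intro a
    have h := hg 0 a
    rw [zero_add] at h
    rw [h]
    field_simp
  have hadd : ∀ a b, c (a + b) = c a * c b := by
    intro a b
    rw [hcg (a + b), hg, hcg a]
    ring
  have hnorm : ∀ a, ‖c a‖ = 1 := by
    intro a
    have h := (translation μ a).norm_map φ
    rw [hc, norm_smul] at h
    exact mul_right_cancel₀ (norm_ne_zero_iff.2 hφ0) (h.trans (one_mul _).symm)
  obtain ⟨σ, hσ⟩ := exists_character_eq ((convolution μ k φ 0)⁻¹ • convolution μ k φ)
    (fun a b => by simpa [← hcg] using hadd a b) (fun a => by simpa [← hcg] using hnorm a)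
  refine ⟨l⁻¹ * convolution μ k φ 0, σ, ?_⟩
  rw [hσ, map_smul, mul_smul, smul_inv_smul₀ hg0]
  exact hφl

/-! ### Adjoints and common kernel of the convolution operators -/

variable [SecondCountableTopology K]

/-- Fubini: convolution with `involution k` is adjoint to convolution with `k`. -/
theorem inner_convolutionLp (k : C(K, ℂ)) (φ ψ : Lp ℂ 2 μ) :
    inner ℂ (convolutionLp μ (involution k) φ) ψ = inner ℂ φ (convolutionLp μ k ψ) := by
  have hφ : Integrable φ μ := (Lp.memLp φ).integrable one_le_two
  have hψ : Integrable ψ μ := (Lp.memLp ψ).integrable one_le_two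
  have hint : Integrable
      (fun p : K × K => (starRingEnd ℂ) (φ p.1) * (k (p.1 - p.2) * ψ p.2)) (μ.prod μ) := by
    have h1 : Integrable (fun p : K × K => (starRingEnd ℂ) (φ p.1) * ψ p.2) (μ.prod μ) :=
      (Complex.conjLIE.toContinuousLinearEquiv.integrable_comp_iff.2 hφ).mul_prod hψ
    have h2 : Continuous fun p : K × K => k (p.1 - p.2) := by fun_prop
    refine (h1.bdd_mul (c := ‖k‖) h2.aestronglyMeasurable
      (Eventually.of_forall fun p => k.norm_coe_le_norm _)).congr (Eventually.of_forall fun p => ?_)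
    simp only
    ring
  rw [convolutionLp_apply, inner_toLp_left, ← inner_conj_symm, convolutionLp_apply,
    inner_toLp_left, ← integral_conj]
  have e1 : ∀ y, (starRingEnd ℂ) (convolution μ (involution k) φ y) * ψ y =
      ∫ x, (starRingEnd ℂ) (φ x) * (k (x - y) * ψ y) ∂μ := by
    intro y
    rw [convolution_apply, ← integral_conj, ← integral_mul_const]
    refine integral_congr_ae (Eventually.of_forall fun x => ?_)
    simp only [involution_apply, map_mul, neg_sub, Complex.conj_conj]
    ring
  have e2 : ∀ x, (starRingEnd ℂ) ((starRingEnd ℂ) (convolution μ k ψ x) * φ x) =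
      ∫ y, (starRingEnd ℂ) (φ x) * (k (x - y) * ψ y) ∂μ := by
    intro x
    rw [integral_const_mul, ← convolution_apply]
    simp [mul_comm]
  simp only [e1, e2]
  exact (integral_integral_swap hint).symm

/-- Continuous functions are dense in `L²(K)`, so an element killed by every convolution operator
vanishes. Splitting `k` into its hermitian and skew-hermitian parts, the self-adjoint convolution
operators suffice. -/
theorem eq_zero_of_forall_convolutionLp_eq_zero (φ : Lp ℂ 2 μ)
    (h : ∀ k : C(K, ℂ), involution k = k → convolutionLp μ k φ = 0) : φ = 0 := by
  have h1 : ∀ k : C(K, ℂ), involution k = k → ∫ y, k (-y) * φ y ∂μ = 0 := by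
    intro k hk
    have h0 : convolution μ k φ = 0 :=
      ContinuousMap.toLp_injective μ ((h k hk).trans (map_zero _).symm)
    simpa [convolution_apply] using DFunLike.congr_fun h0 0
  have hφ : Integrable φ μ := (Lp.memLp φ).integrable one_le_two
  have hint : ∀ k : C(K, ℂ), Integrable (fun y => k (-y) * φ y) μ := fun k =>
    hφ.bdd_mul (c := ‖k‖) (by fun_prop : Continuous fun y => k (-y)).aestronglyMeasurable
      (Eventually.of_forall fun p => k.norm_coe_le_norm _)
  have h2 : ∀ k : C(K, ℂ), ∫ y, k (-y) * φ y ∂μ = 0 := by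
    intro k
    -- `k + k*` and `I • (k - k*)` are hermitian, where `k* = involution k`.
    have ha := h1 (k + involution k) (by ext x; simp [involution_apply, add_comm])
    have hb := h1 (Complex.I • (k - involution k))
      (by ext x; simp [involution_apply]; ring)
    simp only [ContinuousMap.add_apply, add_mul] at ha
    rw [integral_add (hint k) (hint _)] at ha
    simp only [ContinuousMap.smul_apply, smul_eq_mul, mul_assoc, ContinuousMap.sub_apply,
      sub_mul] at hb
    rw [integral_const_mul, integral_sub (hint k) (hint _), mul_eq_zero] at hb
    have hb := hb.resolve_left Complex.I_ne_zero
    linear_combination (ha + hb) / 2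
  refine (ContinuousMap.toLp_denseRange (p := 2) ℂ μ ℂ ENNReal.ofNat_ne_top).eq_zero_of_inner_right ℂ ?_
  intro g
  rw [inner_toLp_left]
  have h := h2 ⟨fun y => (starRingEnd ℂ) (g (-y)), by fun_prop⟩
  simp only [ContinuousMap.coe_mk, neg_neg] at h
  exact h

/-! ### Completeness of the characters -/

theorem convolutionLp_mem_characterOrthogonal {k : C(K, ℂ)} (hk : involution k = k)
    (φ : Lp ℂ 2 μ) (hφ : φ ∈ characterOrthogonal μ) :
    convolutionLp μ k φ ∈ characterOrthogonal μ := by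
  rw [mem_characterOrthogonal] at hφ ⊢
  intro σ
  obtain ⟨c, hc⟩ := convolutionLp_character μ k σ
  rw [← inner_convolutionLp, hk, hc, inner_smul_left, hφ, mul_zero]

/-- Otherwise the orthogonal complement of the characters would contain a common eigenvector of the
convolution and all translations, that is, a multiple of a character. -/
theorem convolutionLp_eq_zero_of_mem {k : C(K, ℂ)} (hk : involution k = k) {φ : Lp ℂ 2 μ}
    (hφ : φ ∈ characterOrthogonal μ) : convolutionLp μ k φ = 0 := by
  by_contra hne
  have hW : CompleteSpace (characterOrthogonal μ) :=
    (Submodule.isClosed_orthogonal _).completeSpace_coe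
  have hsymm : (convolutionLp μ k).IsSymmetric := fun u v => by
    have := inner_convolutionLp μ k u v
    rwa [hk] at this
  obtain ⟨l, hl0, v, hv, hv0, hvl, hvU⟩ :=
    IsCompactOperator.exists_common_eigenvector (isCompactOperator_convolutionLp μ k) hsymm
      (fun a => (translation μ a).toLinearMap) (translation_comm μ)
      (convolutionLp_translation μ k) (characterOrthogonal μ)
      (convolutionLp_mem_characterOrthogonal μ hk) (translation_mem_characterOrthogonal μ) hφ hne
  obtain ⟨d, σ, hσ⟩ := exists_eq_smul_character μ hl0 hv0 hvl hvU
  -- `v` is a multiple of a character and orthogonal to all characters.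
  refine hv0 (inner_self_eq_zero (𝕜 := ℂ) |>.1 ?_)
  nth_rw 1 [hσ]
  rw [inner_smul_left, (mem_characterOrthogonal μ v).1 hv, mul_zero]

theorem characterOrthogonal_eq_bot : characterOrthogonal μ = ⊥ :=
  (Submodule.eq_bot_iff _).2 fun φ hφ => eq_zero_of_forall_convolutionLp_eq_zero μ φ
    fun _ hk => convolutionLp_eq_zero_of_mem μ hk hφ

/-- The characters of a compact second countable abelian group form a Hilbert basis of its `L²` space. -/
noncomputable def characterBasis :
    HilbertBasis (PontryaginDual (Multiplicative K)) ℂ (Lp ℂ 2 μ) :=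
  HilbertBasis.mkOfOrthogonalEqBot (orthonormal_character μ) (characterOrthogonal_eq_bot μ)

theorem characterBasis_apply (σ : PontryaginDual (Multiplicative K)) :
    characterBasis μ σ = ContinuousMap.toLp 2 μ ℂ (character σ) := by
  exact congrFun (HilbertBasis.coe_mkOfOrthogonalEqBot _ _) σ

/-! ### Fourier series of continuous functions -/

theorem characterBasis_repr_toLp (g : C(K, ℂ)) (σ : PontryaginDual (Multiplicative K)) :
    (characterBasis μ).repr (ContinuousMap.toLp 2 μ ℂ g) σ =
      ∫ x, g x * (starRingEnd ℂ) (character σ x) ∂μ := by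
  rw [HilbertBasis.repr_apply_apply, characterBasis_apply, ContinuousMap.inner_toLp]

/-- Plancherel's identity. -/
theorem hasSum_norm_sq_coeff (g : C(K, ℂ)) :
    HasSum (fun σ : PontryaginDual (Multiplicative K) =>
      ‖∫ x, g x * (starRingEnd ℂ) (character σ x) ∂μ‖ ^ 2) (∫ x, ‖g x‖ ^ 2 ∂μ) := by
  have h := (characterBasis μ).hasSum_inner_mul_inner (ContinuousMap.toLp 2 μ ℂ g)
    (ContinuousMap.toLp 2 μ ℂ g)
  simp_rw [← inner_conj_symm (ContinuousMap.toLp 2 μ ℂ g) (characterBasis μ _),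
    ← HilbertBasis.repr_apply_apply, characterBasis_repr_toLp, Complex.conj_mul',
    ContinuousMap.inner_toLp, Complex.mul_conj'] at h
  simp only [← Complex.ofReal_pow, integral_complex_ofReal] at h
  exact Complex.hasSum_ofReal.1 h

theorem tendsto_eLpNorm_sub_fourierSum (g : C(K, ℂ)) :
    Tendsto (fun s : Finset (PontryaginDual (Multiplicative K)) =>
      eLpNorm (fun x => g x - ∑ σ ∈ s,
        (∫ y, g y * (starRingEnd ℂ) (character σ y) ∂μ) * character σ x) 2 μ) atTop (𝓝 0) := by
  have h : Tendsto _ atTop _ := (characterBasis μ).hasSum_repr (ContinuousMap.toLp 2 μ ℂ g)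
  simp only [characterBasis_repr_toLp, characterBasis_apply] at h
  have h2 := (tendsto_iff_edist_tendsto_0.1 h)
  refine h2.congr fun s => ?_
  have hs : ContinuousMap.toLp 2 μ ℂ (g - ∑ σ ∈ s,
      (∫ y, g y * (starRingEnd ℂ) (character σ y) ∂μ) • character σ) =
      ContinuousMap.toLp 2 μ ℂ g - ∑ σ ∈ s, (∫ y, g y * (starRingEnd ℂ) (character σ y) ∂μ) •
        ContinuousMap.toLp 2 μ ℂ (character σ) := by
    simp only [map_sub, map_sum, map_smul]
  rw [edist_comm, edist_eq_enorm_sub, ← hs, Lp.enorm_def]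
  refine eLpNorm_congr_ae ((ContinuousMap.coeFn_toLp (p := 2) (𝕜 := ℂ) μ _).trans
    (Eventually.of_forall fun x => ?_))
  simp

theorem coeff_fourierSum [DecidableEq (PontryaginDual (Multiplicative K))]
    (a : PontryaginDual (Multiplicative K) → ℂ)
    (s : Finset (PontryaginDual (Multiplicative K))) (τ : PontryaginDual (Multiplicative K)) :
    ∫ x, (∑ σ ∈ s, a σ * character σ x) * (starRingEnd ℂ) (character τ x) ∂μ =
      if τ ∈ s then a τ else 0 := by
  have h := characterBasis_repr_toLp μ (∑ σ ∈ s, a σ • character σ) τ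
  rw [HilbertBasis.repr_apply_apply, map_sum, characterBasis_apply] at h
  simp only [map_smul] at h
  simp only [inner_sum, inner_smul_right, orthonormal_iff_ite.1 (orthonormal_character μ),
    mul_ite, mul_one, mul_zero, Finset.sum_ite_eq] at h
  simp only [ContinuousMap.sum_apply, ContinuousMap.smul_apply, smul_eq_mul] at h
  exact h.symm

/-- The sum on the left is the tail over the complement of `s` of the convergent series of squared
coefficients. -/
theorem tendsto_tsum_enorm_coeff_sub (g : C(K, ℂ)) :
    Tendsto (fun s : Finset (PontryaginDual (Multiplicative K)) =>
      ∑' τ : PontryaginDual (Multiplicative K),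
        ‖(∫ x, g x * (starRingEnd ℂ) (character τ x) ∂μ) -
          ∫ x, (∑ σ ∈ s, (∫ y, g y * (starRingEnd ℂ) (character σ y) ∂μ) * character σ x) *
            (starRingEnd ℂ) (character τ x) ∂μ‖ₑ ^ 2) atTop (𝓝 0) := by
  classical
  have hsum := (hasSum_norm_sq_coeff μ g).summable
  set c : PontryaginDual (Multiplicative K) → ℂ :=
    fun σ => ∫ x, g x * (starRingEnd ℂ) (character σ x) ∂μ with hc
  have hfin : ∑' τ, ‖c τ‖ₑ ^ 2 ≠ ∞ := by
    have := hsum.tsum_ofReal_ne_top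
    simpa only [ENNReal.ofReal_pow (norm_nonneg _), ofReal_norm] using this
  refine (ENNReal.tendsto_tsum_compl_atTop_zero hfin).congr fun s => ?_
  refine Eq.trans ?_ (tsum_congr fun τ => by rw [coeff_fourierSum μ c s τ]).symm
  have hind : (fun τ => ‖c τ - if τ ∈ s then c τ else 0‖ₑ ^ 2) =
      {τ | τ ∉ s}.indicator fun τ => ‖c τ‖ₑ ^ 2 := by
    ext τ
    by_cases hτ : τ ∈ s <;> simp [hτ]
  rw [hind]
  exact tsum_subtype {τ | τ ∉ s} fun τ => ‖c τ‖ₑ ^ 2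

end CompactAbelian

namespace AlmostPeriodic

/-! ### The extension to the completed group -/

variable {G : Type*} [AddCommGroup G] [TopologicalSpace G] [IsTopologicalAddGroup G]
  {𝕜 : Type*} [RCLike 𝕜] (f : G →ᵇ 𝕜)

theorem dist_apply_le_dF (a b : G) : dist (f a) (f b) ≤ dF f a b := by
  rw [dF_eq]
  simpa [translate] using BoundedContinuousFunction.dist_coe_le_dist
    (f := translate a f) (g := translate b f) 0

theorem existsUnique_extension :
    ∃! F : C(CompletedGroup f, 𝕜), ∀ x : G, F (toCompleted f x) = f x := by
  have hu : UniformContinuous (fun a : PreGroup f => f a) :=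
    (LipschitzWith.of_dist_le' (K := 1) fun a b : PreGroup f => by
      rw [one_mul]; exact dist_apply_le_dF f a b).uniformContinuous
  refine ⟨⟨Completion.extension fun a : PreGroup f => f a, Completion.continuous_extension⟩,
    fun x => Completion.extension_coe hu x, fun F hF => ?_⟩
  refine ContinuousMap.ext fun y => congrFun ((denseRange_toCompleted f).equalizer F.continuous
    Completion.continuous_extension (funext fun x => ?_)) y
  exact (hF x).trans (Completion.extension_coe hu x).symm

end AlmostPeriodic

theorem mainTheorem4 {G : Type*} [AddCommGroup G] [TopologicalSpace G] [IsTopologicalAddGroup G]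
    {𝕜 : Type*} [RCLike 𝕜] (f : G →ᵇ 𝕜) (hf : AlmostPeriodic.IsAlmostPeriodic f) :
    -- `G_f` is compact and its character group is discrete
    CompactSpace (AlmostPeriodic.CompletedGroup f) ∧
    DiscreteTopology (AlmostPeriodic.CharGroup f) ∧
    -- `f` extends uniquely to a continuous function on `G_f`
    (∃! F : C(AlmostPeriodic.CompletedGroup f, 𝕜),
      ∀ x : G, F (AlmostPeriodic.toCompleted f x) = f x) ∧
    ∀ F : C(AlmostPeriodic.CompletedGroup f, 𝕜),
      (∀ x : G, F (AlmostPeriodic.toCompleted f x) = f x) →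
      -- the extension, regarded as a complex-valued function
      ∀ Φ : AlmostPeriodic.CompletedGroup f → ℂ, (∀ x, Φ x = RCLike.map 𝕜 ℂ (F x)) →
        -- the coefficients are in `ℓ²(Σ)`, with the Plancherel identity
        HasSum (fun σ : AlmostPeriodic.CharGroup f => ‖AlmostPeriodic.fourierCoeff hf Φ σ‖ ^ 2)
          (∫ x, ‖Φ x‖ ^ 2 ∂(AlmostPeriodic.haar f hf)) ∧
        -- the Fourier series converges to the function in `L²(G_f)`
        Tendsto (fun s : Finset (AlmostPeriodic.CharGroup f) =>
            eLpNorm (fun x => Φ x - AlmostPeriodic.fourierSum hf Φ s x) 2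
              (AlmostPeriodic.haar f hf)) atTop (𝓝 0) ∧
        -- on the Fourier side, the series converges to the function in `ℓ²(Σ)`
        Tendsto (fun s : Finset (AlmostPeriodic.CharGroup f) =>
            ∑' τ : AlmostPeriodic.CharGroup f,
              ‖AlmostPeriodic.fourierCoeff hf Φ τ -
                AlmostPeriodic.fourierCoeff hf (AlmostPeriodic.fourierSum hf Φ s) τ‖ₑ ^ 2)
          atTop (𝓝 0) := by
  have := hf.compactSpace
  refine ⟨this, inferInstance, AlmostPeriodic.existsUnique_extension f, fun F _ Φ hΦ => ?_⟩
  have hΦc : Continuous Φ := by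
    rw [funext hΦ]
    exact (RCLike.map 𝕜 ℂ).continuous.comp F.continuous
  exact ⟨CompactAbelian.hasSum_norm_sq_coeff (AlmostPeriodic.haar f hf) ⟨Φ, hΦc⟩,
    CompactAbelian.tendsto_eLpNorm_sub_fourierSum (AlmostPeriodic.haar f hf) ⟨Φ, hΦc⟩,
    CompactAbelian.tendsto_tsum_enorm_coeff_sub (AlmostPeriodic.haar f hf) ⟨Φ, hΦc⟩⟩
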